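/- Let $\mathbf H$ be the skew field of real Hamilton quaternions, let $n\ge 1$, and let $A=(a_{ij})\in M(n,\mathbf H)$. For $i\in\{1,\dots,n\}$ the $i$-th row determinant of $A$ is $$\mathrm{rdet}_i A=\sum_{\sigma\in S_n}(-1)^{n-r}\,a_{i\,i_{k_1}}a_{i_{k_1}i_{k_1+1}}\cdots a_{i_{k_1+l_1}\,i}\;\cdots\;a_{i_{k_r}i_{k_r+1}}\cdots a_{i_{k_r+l_r}i_{k_r}},$$ where $\sigma=(i\,i_{k_1}\dots i_{k_1+l_1})(i_{k_2}\dots i_{k_2+l_2})\cdots(i_{k_r}\dots i_{k_r+l_r})$ is the decomposition of $\sigma$ into its $r$ disjoint cycles (fixed points included), written so that $i$ opens the first cycle, each other cycle is opened by its smallest element, and $i_{k_2}<\dots<i_{k_r}$. For $j\in\{1,\dots,n\}$ the $j$-th column determinant of $A$ is $$\mathrm{cdet}_j A=\sum_{\tau\in S_n}(-1)^{n-r}\,a_{j_{k_r}j_{k_r+l_r}}\cdots a_{j_{k_r+1}j_{k_r}}\;\cdots\;a_{j\,j_{k_1+l_1}}\cdots a_{j_{k_1+1}j_{k_1}}a_{j_{k_1}j},$$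 where $\tau=(j_{k_r+l_r}\dots j_{k_r+1}j_{k_r})\cdots(j_{k_2+l_2}\dots j_{k_2+1}j_{k_2})(j_{k_1+l_1}\dots j_{k_1}\,j)$ with $j$ closing the last cycle on the right, each other cycle ending in its smallest element, and $j_{k_2}<\dots<j_{k_r}$. Let $A^{ii}$ be $A$ with the $i$-th row and column deleted, the remaining rows and columns keeping their labels. The right and left cofactors of $A$, which are the coefficients in $\mathrm{rdet}_iA=\sum_j a_{ij}R_{ij}$ and $\mathrm{cdet}_jA=\sum_i L_{ij}a_{ij}$, are as follows. - For $i\ne j$, $R_{ij}=-\mathrm{rdet}_j$ of the matrix obtained from $A$ by replacing the $j$-th column with the $i$-th column and then deleting the $i$-th row and column; $R_{ii}=\mathrm{rdet}_k A^{ii}$ with $k$ the smallest index different from $i$. - For $i\ne j$, $L_{ij}=-\mathrm{cdet}_i$ of the matrix obtained from $A$ by replacing the $i$-th row with the $j$-th row and then deleting the $j$-th row and column; $L_{jj}=\mathrm{cdet}_k A^{jj}$ with $k$ the smallest index different from $j$. - For $n=1$, $R_{11}=L_{11}=1$. **Theorem.** Let $A\in M(n,\mathbf H)$ be Hermitian,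 that is, $a_{ij}=\overline{a_{ji}}$ for all $i,j$. Then all $\mathrm{rdet}_iA$ and all $\mathrm{cdet}_jA$ are equal to one and the same real number, denoted $\det A$. If $\det A\neq0$, then $A$ has a unique right inverse $(RA)^{-1}$ and a unique left inverse $(LA)^{-1}$, these are $$(RA)^{-1}=\frac1{\det A}\,(R_{ij})^{T},\qquad (LA)^{-1}=\frac1{\det A}\,(L_{ij})^{T},$$ and they coincide: $(RA)^{-1}=(LA)^{-1}=:A^{-1}$. -/

import Mathlib

open scoped Quaternion

noncomputable section

namespace QuatDet

/-- The product of entries of `A` along the cycle of `σ` through `i`, read from `i`: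
`a_{i, σ i} * a_{σ i, σ² i} * ⋯ * a_{σ^(l-1) i, i}`, where `l` is the length of the cycle
(`l = 1` and the product is `a_{i i}` if `i` is a fixed point of `σ`). -/
def cycleProd {ι R : Type*} [Ring R] (A : Matrix ι ι R) (σ : Equiv.Perm ι) (i : ι) : R :=
  ((List.range (Function.minimalPeriod σ i)).map
    (fun k => A ((σ ^ k) i) ((σ ^ (k + 1)) i))).prod

open Classical in
/-- The smallest elements of the cycles of `σ` (fixed points included) that do not contain `i`,
listed in increasing order. -/
def otherCycles {ι : Type*} [Fintype ι] [LinearOrder ι] (σ : Equiv.Perm ι) (i : ι) : List ι :=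
  (Finset.univ.filter
    (fun m : ι => ¬ σ.SameCycle i m ∧ ∀ k : ι, σ.SameCycle m k → m ≤ k)).sort (· ≤ ·)

/-- The `i`-th row determinant: in the monomial of `σ`, the cycle through `i` comes first from the
left and is opened by `i`; the other cycles follow from left to right in increasing order of their
smallest elements, each one opened by its smallest element. The sign of `σ` is `(-1)^(n - r)`,
where `r` is the number of its cycles. -/
def rdet {ι R : Type*} [Fintype ι] [LinearOrder ι] [Ring R] (i : ι) (A : Matrix ι ι R) : R :=
  ∑ σ : Equiv.Perm ι, ((Equiv.Perm.sign σ : ℤ) : R) *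
    (cycleProd A σ i * ((otherCycles σ i).map (cycleProd A σ)).prod)

/-- The `j`-th column determinant: the monomials are written from right to left. In the monomial
of `τ`, the cycle through `j` comes first from the right, its product ending in the column `j`;
the other cycles follow from right to left in increasing order of their smallest elements, the
product of each one ending in the column of its smallest element. As a cycle is closed, the product
along it that ends in the column `m` is the one that starts in the row `m`. -/
def cdet {ι R : Type*} [Fintype ι] [LinearOrder ι] [Ring R] (j : ι) (A : Matrix ι ι R) : R :=
  ∑ τ : Equiv.Perm ι, ((Equiv.Perm.sign τ : ℤ) : R) *
    (((otherCycles τ j).reverse.map (cycleProd A τ)).prod * cycleProd A τ j)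

open Classical in
/-- The row determinant at the smallest index (`1` for the empty matrix). -/
def rdetMin {ι R : Type*} [Fintype ι] [LinearOrder ι] [Ring R] (A : Matrix ι ι R) : R :=
  if h : (Finset.univ : Finset ι).Nonempty then rdet (Finset.univ.min' h) A else 1

open Classical in
/-- The column determinant at the smallest index (`1` for the empty matrix). -/
def cdetMin {ι R : Type*} [Fintype ι] [LinearOrder ι] [Ring R] (A : Matrix ι ι R) : R :=
  if h : (Finset.univ : Finset ι).Nonempty then cdet (Finset.univ.min' h) A else 1

/-- `A^{ii}`: the submatrix obtained by deleting the `i`-th row and the `i`-th column. The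
remaining rows and columns keep their labels and the order of these. -/
def minor {ι R : Type*} (A : Matrix ι ι R) (i : ι) : Matrix {x : ι // x ≠ i} {x : ι // x ≠ i} R :=
  A.submatrix Subtype.val Subtype.val

/-- The right cofactor `R_{ij}`, the coefficient in `rdet_i A = ∑ j, a_{ij} * R_{ij}`: it is
`- rdet_j` of the matrix obtained from `A` by replacing the `j`-th column with the `i`-th one and
then deleting the `i`-th row and column if `i ≠ j`, and `rdet_k (A^{ii})` with `k` the smallest
remaining index if `i = j`. -/
def rightCofactor {ι R : Type*} [Fintype ι] [LinearOrder ι] [Ring R]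
    (A : Matrix ι ι R) (i j : ι) : R :=
  if h : j ≠ i then - rdet (⟨j, h⟩ : {x : ι // x ≠ i}) (minor (A.updateCol j (fun s => A s i)) i)
  else rdetMin (minor A i)

/-- The left cofactor `L_{ij}`, the coefficient in `cdet_j A = ∑ i, L_{ij} * a_{ij}`: it is
`- cdet_i` of the matrix obtained from `A` by replacing the `i`-th row with the `j`-th one and then
deleting the `j`-th row and column if `i ≠ j`, and `cdet_k (A^{jj})` with `k` the smallest
remaining index if `i = j`. -/
def leftCofactor {ι R : Type*} [Fintype ι] [LinearOrder ι] [Ring R]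
    (A : Matrix ι ι R) (i j : ι) : R :=
  if h : i ≠ j then - cdet (⟨i, h⟩ : {x : ι // x ≠ j}) (minor (A.updateRow i (A j)) j)
  else cdetMin (minor A j)

/-- The determinant of a Hermitian matrix, read off as one of its row determinants. (All row and
column determinants of a Hermitian quaternion matrix are equal to it.) -/
def hermDet {ι R : Type*} [Fintype ι] [LinearOrder ι] [Ring R] (A : Matrix ι ι R) : R :=
  rdetMin A

/-- `1 / det A` times the transposed matrix of the right cofactors. -/
def rightInv {n : ℕ} (A : Matrix (Fin n) (Fin n) ℍ[ℝ]) : Matrix (Fin n) (Fin n) ℍ[ℝ] :=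
  (hermDet A)⁻¹ • (Matrix.of (rightCofactor A)).transpose

/-- `1 / det A` times the transposed matrix of the left cofactors. -/
def leftInv {n : ℕ} (A : Matrix (Fin n) (Fin n) ℍ[ℝ]) : Matrix (Fin n) (Fin n) ℍ[ℝ] :=
  (hermDet A)⁻¹ • (Matrix.of (leftCofactor A)).transpose

end QuatDet

end

/-!
In the monomial of a permutation `σ` every cycle contributes one factor, the product of the entries
read along it. Reversing the cycle of `σ` through a given `m` (`flipCycle`) is an involution of the
symmetric group that preserves the sign and the partition into cycles. If `A` is Hermitian, it
conjugates the factor of that cycle and leaves the other factors alone, so that inside the sum this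
factor may be replaced by its real part (`sum_mixedFactor_insert`). Doing this for every cycle gives
`rdet_i A = ∑ σ, sign σ * ∏ c, Re (product along c)`. The real part does not depend on the element
at which a cycle is opened, hence this real number does not depend on `i`
(`rdet_eq_rdet_of_isHermitian`). Column determinants follow by conjugation: for every matrix,
`star (rdet_i A) = cdet_i Aᴴ` (`star_rdet`).

For the inverse, the cofactor expansion `rdet_i A = ∑ k, a_{ik} R_{ik}` holds for every matrix
(`rdet_eq_sum_mul_rightCofactor`): a permutation `σ` with `σ i = k` amounts to a permutation of the
other indices into whose cycles `i` is inserted just before `k`. Since `R_{jk}` does not involve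
the `j`-th row, `∑ k, a_{ik} R_{jk}` for `i ≠ j` is the `j`-th row determinant of the matrix `B`
obtained from `A` by replacing its `j`-th row with the `i`-th one. It vanishes
(`rdet_updateRow_eq_zero`). Indeed, pair each `σ` that has `i` and `j` in different cycles, with
factors `P` through `i` and `Q` through `j`, with `σ * swap i j`, which merges the two cycles and,
as the rows `i` and `j` of `B` agree, has the factor `P * Q` instead. The cycles without `j` only
meet entries of `A`, so that `P` may be averaged in both sums over `σ`; the real number `Re P`
commutes with `Q`, and the two signs are opposite.

Hence `A * Rᵀ` is the scalar matrix `det A`. Taking conjugate transposes turns right cofactors into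
left ones (`star_rightCofactor`), so the left inverse comes for free, and a matrix with a right
inverse and a left inverse has no other ones.
-/

namespace QuatDet

open Equiv Equiv.Perm

/-! ### Products along cycles -/

section Cycles

variable {ι κ R : Type*}

theorem sameCycle_iff_exists_nat_pow [Finite ι] {σ : Perm ι} {x y : ι} :
    σ.SameCycle x y ↔ ∃ n : ℕ, (σ ^ n) x = y :=
  ⟨fun h => h.exists_nat_pow_eq, fun ⟨n, hn⟩ => ⟨n, by simpa using hn⟩⟩

theorem pow_apply_eq_of_eqOn_cycle {σ τ : Perm ι} {x : ι}
    (h : ∀ y, σ.SameCycle x y → τ y = σ y) (t : ℕ) : (τ ^ t) x = (σ ^ t) x := by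
  induction t with
  | zero => rfl
  | succ t ih =>
    rw [pow_succ', pow_succ', Perm.mul_apply, Perm.mul_apply, ih,
      h _ (sameCycle_pow_right.2 (SameCycle.refl _ _))]

theorem minimalPeriod_pos [Finite ι] (σ : Perm ι) (x : ι) : 0 < Function.minimalPeriod σ x :=
  Function.minimalPeriod_pos_of_mem_periodicPts (σ.injective.mem_periodicPts x)

theorem pow_minimalPeriod_apply (σ : Perm ι) (x : ι) :
    (σ ^ Function.minimalPeriod σ x) x = x := by
  rw [← Perm.iterate_eq_pow]
  exact Function.isPeriodicPt_minimalPeriod σ x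

theorem pow_apply_ne_of_lt_minimalPeriod {σ : Perm ι} {x : ι} {t : ℕ} (h0 : t ≠ 0)
    (ht : t < Function.minimalPeriod σ x) : (σ ^ t) x ≠ x := by
  rw [← Perm.iterate_eq_pow]
  exact Function.not_isPeriodicPt_of_pos_of_lt_minimalPeriod h0 ht

theorem minimalPeriod_eq_of_first_return {σ : Perm ι} {x : ι} {n : ℕ} (hn : 0 < n)
    (hx : (σ ^ n) x = x) (h : ∀ t, 0 < t → t < n → (σ ^ t) x ≠ x) :
    Function.minimalPeriod σ x = n := by
  have hp : Function.IsPeriodicPt σ n x := by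
    rw [Function.IsPeriodicPt, Function.IsFixedPt, Perm.iterate_eq_pow]; exact hx
  refine le_antisymm (hp.minimalPeriod_le hn) (not_lt.1 fun hlt => ?_)
  exact h _ (hp.minimalPeriod_pos hn) hlt (pow_minimalPeriod_apply σ x)

theorem SameCycle.exists_pow_lt_minimalPeriod [Finite ι] {σ : Perm ι} {x y : ι}
    (h : σ.SameCycle x y) : ∃ t < Function.minimalPeriod σ x, (σ ^ t) x = y := by
  obtain ⟨n, rfl⟩ := h.exists_nat_pow_eq
  refine ⟨n % Function.minimalPeriod σ x, Nat.mod_lt _ (minimalPeriod_pos σ x), ?_⟩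
  rw [← Perm.iterate_eq_pow, ← Perm.iterate_eq_pow, Function.iterate_mod_minimalPeriod_eq]

/-- The cycle product only depends on the entries of the matrix along the orbit. -/
theorem cycleProd_eq_of_orbit [Ring R] {e : κ → ι} (he : Function.Injective e) {σ : Perm ι}
    {τ : Perm κ} {A : Matrix ι ι R} {B : Matrix κ κ R} {x : κ}
    (h : ∀ t : ℕ, (σ ^ t) (e x) = e ((τ ^ t) x))
    (hAB : ∀ y, τ.SameCycle x y → A (e y) (e (τ y)) = B y (τ y)) :
    cycleProd A σ (e x) = cycleProd B τ x := by
  have hp : Function.minimalPeriod σ (e x) = Function.minimalPeriod τ x := by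
    rw [Function.minimalPeriod_eq_minimalPeriod_iff]
    intro n
    rw [Function.IsPeriodicPt, Function.IsFixedPt, Function.IsPeriodicPt, Function.IsFixedPt,
      Perm.iterate_eq_pow, Perm.iterate_eq_pow, h, he.eq_iff]
  unfold cycleProd
  rw [hp]
  congr 1
  refine List.map_congr_left fun t _ => ?_
  rw [h, h, pow_succ', Perm.mul_apply]
  exact hAB _ (sameCycle_pow_right.2 (SameCycle.refl _ _))

theorem cycleProd_congr [Ring R] {σ τ : Perm ι} {A B : Matrix ι ι R} {x : ι}
    (h : ∀ y, τ.SameCycle x y → σ y = τ y)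
    (hAB : ∀ y, τ.SameCycle x y → A y (τ y) = B y (τ y)) :
    cycleProd A σ x = cycleProd B τ x :=
  cycleProd_eq_of_orbit (e := id) Function.injective_id
    (pow_apply_eq_of_eqOn_cycle h) hAB

theorem star_prod_map_range [Ring R] [StarRing R] (f : ℕ → R) (n : ℕ) :
    star ((List.range n).map f).prod = ((List.range n).map fun t => star (f (n - 1 - t))).prod := by
  induction n generalizing f with
  | zero => simp
  | succ n ih =>
    rw [List.range_succ_eq_map, List.map_cons, List.prod_cons, star_mul, List.map_map, ih,
      ← List.range_succ_eq_map, List.range_succ, List.map_append, List.prod_append]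
    simp only [List.map_cons, List.map_nil, List.prod_cons, List.prod_nil, mul_one]
    congr 2
    · refine List.map_congr_left fun t ht => ?_
      have := List.mem_range.1 ht
      simp only [Function.comp]
      congr 2
      omega
    · simp

/-- Reading a cycle backwards conjugates its product. -/
theorem star_cycleProd [Ring R] [StarRing R] (A : Matrix ι ι R) (σ : Perm ι) (x : ι) :
    star (cycleProd A σ x) = cycleProd A.conjTranspose σ⁻¹ x := by
  have hp : Function.minimalPeriod (σ⁻¹ : Perm ι) x = Function.minimalPeriod σ x := by
    rw [Function.minimalPeriod_eq_minimalPeriod_iff]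
    intro n
    rw [Function.IsPeriodicPt, Function.IsFixedPt, Function.IsPeriodicPt, Function.IsFixedPt,
      Perm.iterate_eq_pow, Perm.iterate_eq_pow, inv_pow, Perm.inv_eq_iff_eq, eq_comm]
  unfold cycleProd
  rw [star_prod_map_range, hp]
  congr 1
  refine List.map_congr_left fun t ht => ?_
  have ht := List.mem_range.1 ht
  have key : ∀ s, s ≤ Function.minimalPeriod σ x →
      (σ⁻¹ ^ s) x = (σ ^ (Function.minimalPeriod σ x - s)) x := by
    intro s hs
    rw [inv_pow, Perm.inv_eq_iff_eq, ← Perm.mul_apply, ← pow_add, Nat.add_sub_cancel' hs,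
      pow_minimalPeriod_apply]
  rw [Matrix.conjTranspose_apply, key t ht.le, key (t + 1) ht]
  congr 4 <;> omega

theorem re_mul_comm (a b : ℍ[ℝ]) : (a * b).re = (b * a).re := by
  simp only [Quaternion.re_mul]; ring

theorem re_cycleProd_apply [Finite ι] (A : Matrix ι ι ℍ[ℝ]) (σ : Perm ι) (x : ι) :
    (cycleProd A σ (σ x)).re = (cycleProd A σ x).re := by
  unfold cycleProd
  rw [Function.minimalPeriod_apply (σ.injective.mem_periodicPts x)]
  obtain ⟨n, hn⟩ := Nat.exists_eq_succ_of_ne_zero (minimalPeriod_pos σ x).ne'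
  have hx := pow_minimalPeriod_apply σ x
  rw [hn] at hx ⊢
  have hs : ∀ t : ℕ, (σ ^ t) (σ x) = (σ ^ (t + 1)) x := fun t => by
    rw [pow_succ, Perm.mul_apply]
  have hy : (σ ^ (n.succ + 1)) x = σ x := by rw [pow_succ', Perm.mul_apply, hx]
  have hx' : (σ ^ (n + 1)) x = x := hx
  have hy' : (σ ^ (n + 1 + 1)) x = σ x := hy
  rw [List.prod_range_succ, List.prod_range_succ', re_mul_comm]
  simp only [hs, hx', hy', zero_add, pow_zero, pow_one, Perm.one_apply, Nat.succ_eq_add_one]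

theorem re_cycleProd_eq_of_sameCycle [Finite ι] (A : Matrix ι ι ℍ[ℝ]) {σ : Perm ι} {x y : ι}
    (h : σ.SameCycle x y) : (cycleProd A σ x).re = (cycleProd A σ y).re := by
  obtain ⟨n, rfl⟩ := h.exists_nat_pow_eq
  induction n with
  | zero => rfl
  | succ n ih =>
    rw [ih (sameCycle_pow_right.2 (SameCycle.refl _ _)), pow_succ', Perm.mul_apply,
      re_cycleProd_apply]

end Cycles

/-! ### Reversing one cycle -/

section CycleReversal

variable {ι : Type*}

open Classical in
/-- The permutation `σ` with its cycle through `m` reversed. -/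
noncomputable def flipCycle (m : ι) (σ : Perm ι) : Perm ι :=
  σ * (σ.cycleOf m)⁻¹ * (σ.cycleOf m)⁻¹

theorem flipCycle_apply_of_sameCycle {m x : ι} {σ : Perm ι} (h : σ.SameCycle m x) :
    flipCycle m σ x = σ⁻¹ x := by
  classical
  have h' : (σ⁻¹).SameCycle m x := sameCycle_inv.2 h
  have h'' : (σ⁻¹).SameCycle m (σ⁻¹ x) := sameCycle_apply_right.2 h'
  rw [flipCycle, Perm.mul_apply, Perm.mul_apply, cycleOf_inv, h'.cycleOf_apply,
    h''.cycleOf_apply]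
  simp

theorem flipCycle_apply_of_not_sameCycle {m x : ι} {σ : Perm ι} (h : ¬σ.SameCycle m x) :
    flipCycle m σ x = σ x := by
  classical
  have h' : ¬(σ⁻¹).SameCycle m x := mt sameCycle_inv.1 h
  rw [flipCycle, Perm.mul_apply, Perm.mul_apply, cycleOf_inv, cycleOf_apply_of_not_sameCycle h',
    cycleOf_apply_of_not_sameCycle h']

theorem sign_flipCycle [Fintype ι] [DecidableEq ι] (m : ι) (σ : Perm ι) :
    sign (flipCycle m σ) = sign σ := by
  rw [flipCycle, Perm.sign_mul, Perm.sign_mul, mul_assoc, Int.units_mul_self, mul_one]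

theorem flipCycle_pow_apply_of_sameCycle {m x : ι} {σ : Perm ι} (h : σ.SameCycle m x) (t : ℕ) :
    (flipCycle m σ ^ t) x = (σ⁻¹ ^ t) x :=
  pow_apply_eq_of_eqOn_cycle
    (fun _ hy => flipCycle_apply_of_sameCycle (h.trans (sameCycle_inv.1 hy))) t

theorem flipCycle_pow_apply_of_not_sameCycle {m x : ι} {σ : Perm ι} (h : ¬σ.SameCycle m x)
    (t : ℕ) : (flipCycle m σ ^ t) x = (σ ^ t) x :=
  pow_apply_eq_of_eqOn_cycle
    (fun _ hy => flipCycle_apply_of_not_sameCycle fun h' => h (h'.trans hy.symm)) t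

theorem sameCycle_flipCycle [Finite ι] {m x y : ι} {σ : Perm ι} :
    (flipCycle m σ).SameCycle x y ↔ σ.SameCycle x y := by
  by_cases h : σ.SameCycle m x
  · rw [← sameCycle_inv (f := σ), sameCycle_iff_exists_nat_pow, sameCycle_iff_exists_nat_pow]
    simp only [flipCycle_pow_apply_of_sameCycle h]
  · rw [sameCycle_iff_exists_nat_pow, sameCycle_iff_exists_nat_pow]
    simp only [flipCycle_pow_apply_of_not_sameCycle h]

theorem flipCycle_flipCycle [Finite ι] (m : ι) (σ : Perm ι) : flipCycle m (flipCycle m σ) = σ := by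
  ext x
  by_cases h : σ.SameCycle m x
  · rw [flipCycle_apply_of_sameCycle (sameCycle_flipCycle.2 h), Perm.inv_eq_iff_eq,
      flipCycle_apply_of_sameCycle (sameCycle_apply_right.2 h)]
    simp
  · rw [flipCycle_apply_of_not_sameCycle (mt sameCycle_flipCycle.1 h),
      flipCycle_apply_of_not_sameCycle h]

end CycleReversal

/-! ### Averaging over cycle reversals -/

section Averaging

variable {ι : Type*}

/-- The product along the cycle of `σ` through `m`, replaced by its real part if `m ∈ S`. -/
noncomputable def mixedFactor [DecidableEq ι] (B : Matrix ι ι ℍ[ℝ]) (S : Finset ι) (σ : Perm ι)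
    (m : ι) : ℍ[ℝ] :=
  if m ∈ S then ((cycleProd B σ m).re : ℍ[ℝ]) else cycleProd B σ m

theorem cycleProd_flipCycle_self {B : Matrix ι ι ℍ[ℝ]} {σ : Perm ι} {m : ι}
    (hB : ∀ x y, σ.SameCycle m x → σ.SameCycle m y → B x y = star (B y x)) :
    cycleProd B (flipCycle m σ) m = star (cycleProd B σ m) := by
  rw [star_cycleProd]
  refine cycleProd_congr (fun y hy => flipCycle_apply_of_sameCycle (sameCycle_inv.1 hy))
    fun y hy => ?_
  rw [Matrix.conjTranspose_apply]
  exact hB _ _ (sameCycle_inv.1 hy) (sameCycle_inv.1 (sameCycle_apply_right.2 hy))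

theorem cycleProd_flipCycle_of_not_sameCycle (B : Matrix ι ι ℍ[ℝ]) {σ : Perm ι} {m x : ι}
    (h : ¬σ.SameCycle m x) : cycleProd B (flipCycle m σ) x = cycleProd B σ x :=
  cycleProd_congr (fun _ hy => flipCycle_apply_of_not_sameCycle fun h' => h (h'.trans hy.symm))
    fun _ _ => rfl

/-- A product of values of a class function over representatives of cycles does not depend on the
choice of the representatives nor on their order. -/
theorem prod_map_eq_of_representatives {M : Type*} [CommMonoid M] {σ : Perm ι} {f : ι → M}
    (hf : ∀ x y, σ.SameCycle x y → f x = f y) {l₁ l₂ : List ι}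
    (h₁ : l₁.Pairwise fun x y => ¬σ.SameCycle x y) (h₂ : l₂.Pairwise fun x y => ¬σ.SameCycle x y)
    (h₁₂ : ∀ x ∈ l₁, ∃ y ∈ l₂, σ.SameCycle x y) (h₂₁ : ∀ y ∈ l₂, ∃ x ∈ l₁, σ.SameCycle x y) :
    (l₁.map f).prod = (l₂.map f).prod := by
  let s := SameCycle.setoid σ
  have hmk : ∀ x y, (Quotient.mk s x = Quotient.mk s y) ↔ σ.SameCycle x y := fun x y =>
    Quotient.eq (r := s)
  have hlift : ∀ l : List ι, l.map f = (l.map (Quotient.mk s)).map (Quotient.lift f hf) := by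
    intro l; rw [List.map_map]; rfl
  rw [hlift, hlift]
  refine (List.Perm.map _ ?_).prod_eq
  have nd : ∀ l : List ι, (l.Pairwise fun x y => ¬σ.SameCycle x y) →
      (l.map (Quotient.mk s)).Nodup := fun l hl => by
    rw [List.Nodup, List.pairwise_map]
    exact hl.imp fun h h' => h ((hmk _ _).1 h')
  rw [List.perm_ext_iff_of_nodup (nd _ h₁) (nd _ h₂)]
  intro q
  simp only [List.mem_map]
  constructor
  · rintro ⟨x, hx, rfl⟩
    obtain ⟨y, hy, h⟩ := h₁₂ x hx
    exact ⟨y, hy, ((hmk _ _).2 h).symm⟩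
  · rintro ⟨y, hy, rfl⟩
    obtain ⟨x, hx, h⟩ := h₂₁ y hy
    exact ⟨x, hx, (hmk _ _).2 h⟩

theorem prod_map_coe (f : ι → ℝ) (l : List ι) :
    (l.map fun m => ((f m : ℝ) : ℍ[ℝ])).prod = (((l.map f).prod : ℝ) : ℍ[ℝ]) := by
  induction l with
  | nil => simp
  | cons a l ih => simp [ih]

variable [DecidableEq ι]

/-- If `m` occurs among the representatives `l`, the two sides agree because `q + star q = 2 * Re q`
for the factor `q` at `m`; otherwise their summands agree. -/
theorem prod_mixedFactor_add_flipCycle {B : Matrix ι ι ℍ[ℝ]} {σ : Perm ι} {m : ι} {S : Finset ι}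
    (hm : m ∉ S) {l : List ι} (hl : l.Pairwise fun x y => ¬σ.SameCycle x y)
    (hB : m ∈ l → ∀ x y, σ.SameCycle m x → σ.SameCycle m y → B x y = star (B y x)) :
    (l.map (mixedFactor B S σ)).prod + (l.map (mixedFactor B S (flipCycle m σ))).prod =
      (l.map (mixedFactor B (insert m S) σ)).prod +
        (l.map (mixedFactor B (insert m S) (flipCycle m σ))).prod := by
  -- Factors at the other representatives are not affected at all
  have key : ∀ l' : List ι, (∀ x ∈ l', x ≠ m ∧ (m ∈ l → ¬σ.SameCycle m x)) →
      l'.map (mixedFactor B (insert m S) σ) = l'.map (mixedFactor B S σ) ∧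
      l'.map (mixedFactor B (insert m S) (flipCycle m σ)) =
        l'.map (mixedFactor B S (flipCycle m σ)) ∧
      (m ∈ l → l'.map (mixedFactor B S (flipCycle m σ)) = l'.map (mixedFactor B S σ)) := by
    refine fun l' h => ⟨List.map_congr_left fun x hx => ?_, List.map_congr_left fun x hx => ?_,
      fun hml => List.map_congr_left fun x hx => ?_⟩
    · simp [mixedFactor, (h x hx).1]
    · simp [mixedFactor, (h x hx).1]
    · simp only [mixedFactor, cycleProd_flipCycle_of_not_sameCycle B ((h x hx).2 hml)]
  by_cases hml : m ∈ l
  · specialize hB hml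
    have hf := cycleProd_flipCycle_self hB
    obtain ⟨s, t, rfl⟩ := List.append_of_mem hml
    rw [List.pairwise_append, List.pairwise_cons] at hl
    obtain ⟨-, ⟨ht, -⟩, hs⟩ := hl
    have ks := key s fun x hx => by
      have := hs x hx m (by simp)
      exact ⟨fun h => this (h ▸ SameCycle.refl _ _), fun _ h => this h.symm⟩
    have kt := key t fun x hx => by
      have := ht x hx
      exact ⟨fun h => this (h ▸ SameCycle.refl _ _), fun _ h => this h⟩
    simp only [List.map_append, List.map_cons, List.prod_append, List.prod_cons, ks.1, ks.2.1,
      kt.1, kt.2.1, ks.2.2 hml, kt.2.2 hml]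
    rw [← mul_add, ← mul_add, ← add_mul, ← add_mul]
    congr 2
    simp only [mixedFactor, hm, if_false, Finset.mem_insert_self, if_true, hf,
      Quaternion.self_add_star', Quaternion.re_star]
    rw [← Quaternion.coe_add, two_mul]
  · have k := key l fun x hx => ⟨fun h => hml (h ▸ hx), fun h => absurd h hml⟩
    rw [k.1, k.2.1]

variable [Fintype ι]

/-- One averaging step: the involution `flipCycle m` replaces the product along the cycle through
`m` by its conjugate and keeps everything else, so that this product may be replaced by its
real part. -/
theorem sum_mixedFactor_insert {B : Matrix ι ι ℍ[ℝ]} {T : Finset (Perm ι)} {L : Perm ι → List ι}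
    {m : ι} {S : Finset ι} (hm : m ∉ S) (hT : ∀ σ ∈ T, flipCycle m σ ∈ T)
    (hL : ∀ σ ∈ T, L (flipCycle m σ) = L σ)
    (hsep : ∀ σ ∈ T, (L σ).Pairwise fun x y => ¬σ.SameCycle x y)
    (hB : ∀ σ ∈ T, m ∈ L σ → ∀ x y, σ.SameCycle m x → σ.SameCycle m y → B x y = star (B y x)) :
    ∑ σ ∈ T, ((sign σ : ℤ) : ℍ[ℝ]) * ((L σ).map (mixedFactor B S σ)).prod =
      ∑ σ ∈ T, ((sign σ : ℤ) : ℍ[ℝ]) * ((L σ).map (mixedFactor B (insert m S) σ)).prod := by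
  have double : ∀ f : Perm ι → ℍ[ℝ],
      (2 : ℍ[ℝ]) * ∑ σ ∈ T, f σ = ∑ σ ∈ T, (f σ + f (flipCycle m σ)) := fun f => by
    rw [Finset.sum_add_distrib, two_mul]
    congr 1
    exact Finset.sum_bij' (fun σ _ => flipCycle m σ) (fun σ _ => flipCycle m σ) hT hT
      (fun σ _ => flipCycle_flipCycle m σ) (fun σ _ => flipCycle_flipCycle m σ)
      (fun σ _ => by rw [flipCycle_flipCycle])
  have h2 : (2 : ℍ[ℝ]) ≠ 0 := fun h => two_ne_zero (α := ℝ) (congrArg QuaternionAlgebra.re h)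
  refine mul_left_cancel₀ h2 ?_
  rw [double, double]
  refine Finset.sum_congr rfl fun σ hσ => ?_
  rw [sign_flipCycle, hL σ hσ, ← mul_add, ← mul_add,
    prod_mixedFactor_add_flipCycle hm (hsep σ hσ) (hB σ hσ)]

theorem sum_cycleProd_eq_sum_mixedFactor {B : Matrix ι ι ℍ[ℝ]} {T : Finset (Perm ι)}
    {L : Perm ι → List ι} (S : Finset ι) (hT : ∀ m, ∀ σ ∈ T, flipCycle m σ ∈ T)
    (hL : ∀ m, ∀ σ ∈ T, L (flipCycle m σ) = L σ)
    (hsep : ∀ σ ∈ T, (L σ).Pairwise fun x y => ¬σ.SameCycle x y)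
    (hB : ∀ m ∈ S, ∀ σ ∈ T, m ∈ L σ →
      ∀ x y, σ.SameCycle m x → σ.SameCycle m y → B x y = star (B y x)) :
    ∑ σ ∈ T, ((sign σ : ℤ) : ℍ[ℝ]) * ((L σ).map (cycleProd B σ)).prod =
      ∑ σ ∈ T, ((sign σ : ℤ) : ℍ[ℝ]) * ((L σ).map (mixedFactor B S σ)).prod := by
  induction S using Finset.induction_on with
  | empty =>
    have : ∀ σ, mixedFactor B ∅ σ = cycleProd B σ := fun σ => by ext1 m; simp [mixedFactor]
    simp only [this]
  | insert m S hm ih =>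
    rw [ih fun m' hm' => hB m' (Finset.mem_insert_of_mem hm')]
    exact sum_mixedFactor_insert hm (hT m) (hL m) hsep (hB m (Finset.mem_insert_self m S))

end Averaging

/-! ### Representatives of the cycles -/

section OtherCycles

theorem eq_of_sortedLT_of_mem_iff {ι : Type*} [LinearOrder ι] {l₁ l₂ : List ι} (h₁ : l₁.SortedLT) (h₂ : l₂.SortedLT)
    (h : ∀ x, x ∈ l₁ ↔ x ∈ l₂) : l₁ = l₂ :=
  List.Perm.eq_of_sortedLE h₁.sortedLE h₂.sortedLE
    ((List.perm_ext_iff_of_nodup h₁.nodup h₂.nodup).2 h)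

variable {ι : Type*} [Fintype ι] [LinearOrder ι]

theorem mem_otherCycles {σ : Perm ι} {i m : ι} :
    m ∈ otherCycles σ i ↔ ¬σ.SameCycle i m ∧ ∀ k, σ.SameCycle m k → m ≤ k := by
  simp [otherCycles]

theorem sortedLT_otherCycles (σ : Perm ι) (i : ι) : (otherCycles σ i).SortedLT :=
  Finset.sortedLT_sort _

theorem otherCycles_congr {σ τ : Perm ι} {i : ι}
    (h : ∀ x y, σ.SameCycle x y ↔ τ.SameCycle x y) : otherCycles σ i = otherCycles τ i :=
  eq_of_sortedLT_of_mem_iff (sortedLT_otherCycles σ i) (sortedLT_otherCycles τ i) fun x => by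
    simp only [mem_otherCycles, h]

theorem pairwise_otherCycles (σ : Perm ι) (i : ι) :
    (otherCycles σ i).Pairwise fun x y => ¬σ.SameCycle x y := by
  refine (sortedLT_otherCycles σ i).pairwise.imp_of_mem fun {x y} _ hy hxy h => ?_
  exact absurd ((mem_otherCycles.1 hy).2 x h.symm) (not_le.2 hxy)

theorem pairwise_cons_otherCycles (σ : Perm ι) (i : ι) :
    (i :: otherCycles σ i).Pairwise fun x y => ¬σ.SameCycle x y :=
  List.pairwise_cons.2 ⟨fun _ hm => (mem_otherCycles.1 hm).1, pairwise_otherCycles σ i⟩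

/-- Every cycle has a smallest element. -/
theorem exists_sameCycle_least (σ : Perm ι) (x : ι) :
    ∃ m, σ.SameCycle x m ∧ ∀ k, σ.SameCycle m k → m ≤ k := by
  classical
  obtain ⟨m, hm, hmin⟩ := Finset.exists_min_image (Finset.univ.filter fun y => σ.SameCycle x y) id
    ⟨x, by simp [SameCycle.refl]⟩
  simp only [Finset.mem_filter, Finset.mem_univ, true_and, id] at hm hmin
  exact ⟨m, hm, fun k hk => hmin k (hm.trans hk)⟩

theorem exists_mem_otherCycles {σ : Perm ι} {i x : ι} (h : ¬σ.SameCycle i x) :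
    ∃ y ∈ otherCycles σ i, σ.SameCycle x y := by
  obtain ⟨m, hm, hmin⟩ := exists_sameCycle_least σ x
  exact ⟨m, mem_otherCycles.2 ⟨fun h' => h (h'.trans hm.symm), hmin⟩, hm⟩

theorem exists_mem_cons_otherCycles (σ : Perm ι) (i x : ι) :
    ∃ y ∈ i :: otherCycles σ i, σ.SameCycle x y := by
  by_cases h : σ.SameCycle i x
  · exact ⟨i, by simp, h.symm⟩
  · obtain ⟨y, hy, hxy⟩ := exists_mem_otherCycles h
    exact ⟨y, List.mem_cons_of_mem _ hy, hxy⟩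

end OtherCycles

/-! ### Row and column determinants of Hermitian matrices -/

section Hermitian

variable {ι : Type*} [Fintype ι] [LinearOrder ι]

theorem rdet_eq_sum_cons (A : Matrix ι ι ℍ[ℝ]) (i : ι) :
    rdet i A = ∑ σ : Perm ι,
      ((sign σ : ℤ) : ℍ[ℝ]) * ((i :: otherCycles σ i).map (cycleProd A σ)).prod := by
  simp only [rdet, List.map_cons, List.prod_cons]

theorem rdet_eq_coe_of_isHermitian {A : Matrix ι ι ℍ[ℝ]} (hA : A.IsHermitian) (i : ι) :
    rdet i A = ((∑ σ : Perm ι, ((sign σ : ℤ) : ℝ) *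
      ((i :: otherCycles σ i).map fun m => (cycleProd A σ m).re).prod : ℝ) : ℍ[ℝ]) := by
  rw [rdet_eq_sum_cons, sum_cycleProd_eq_sum_mixedFactor Finset.univ (fun _ _ _ => Finset.mem_univ _)
    (fun m σ _ => by rw [otherCycles_congr fun _ _ => sameCycle_flipCycle])
    (fun σ _ => pairwise_cons_otherCycles σ i) (fun _ _ _ _ _ x y _ _ => (hA.apply x y).symm)]
  have : ∀ σ : Perm ι, mixedFactor A Finset.univ σ = fun m => (((cycleProd A σ m).re : ℝ) : ℍ[ℝ]) :=
    fun σ => by ext1 m; simp [mixedFactor]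
  simp only [this, prod_map_coe]
  rw [← Quaternion.algebraMap_def, map_sum]
  refine Finset.sum_congr rfl fun σ _ => ?_
  rw [map_mul, map_intCast]

theorem rdet_eq_rdet_of_isHermitian {A : Matrix ι ι ℍ[ℝ]} (hA : A.IsHermitian) (i j : ι) :
    rdet i A = rdet j A := by
  rw [rdet_eq_coe_of_isHermitian hA, rdet_eq_coe_of_isHermitian hA]
  congr 1
  refine Finset.sum_congr rfl fun σ _ => ?_
  congr 1
  exact prod_map_eq_of_representatives (σ := σ) (fun _ _ h => re_cycleProd_eq_of_sameCycle A h)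
    (pairwise_cons_otherCycles σ i) (pairwise_cons_otherCycles σ j)
    (fun x _ => exists_mem_cons_otherCycles σ j x)
    (fun y _ => (exists_mem_cons_otherCycles σ i y).imp fun _ h => ⟨h.1, h.2.symm⟩)

/-- Conjugation exchanges row and column determinants, for every square matrix. -/
theorem star_rdet (A : Matrix ι ι ℍ[ℝ]) (i : ι) : star (rdet i A) = cdet i A.conjTranspose := by
  unfold rdet cdet
  rw [star_sum]
  refine Fintype.sum_equiv (Equiv.inv _) _ _ fun σ => ?_
  have hother : otherCycles σ⁻¹ i = otherCycles σ i :=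
    otherCycles_congr fun _ _ => sameCycle_inv
  have hstar : ∀ l : List ι, star (l.map (cycleProd A σ)).prod =
      (l.reverse.map (cycleProd A.conjTranspose σ⁻¹)).prod := fun l => by
    induction l with
    | nil => simp
    | cons a l ih =>
      rw [List.map_cons, List.prod_cons, star_mul, ih, List.reverse_cons, List.map_append,
        List.prod_append, star_cycleProd]
      simp
  rw [Equiv.inv_apply, sign_inv, hother, star_mul, star_mul, hstar, star_cycleProd, star_intCast]
  exact (Int.cast_commute _ _).eq.symm

end Hermitian

/-! ### Inserting a point into a permutation -/

section Expansion

variable {ι R : Type*} [DecidableEq ι]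

/-- The permutation of `ι` obtained from a permutation `τ` of `{x // x ≠ i}` by inserting `i` right
before `k` in its cycle, or by adding the fixed point `i` if `k = i`. -/
def extendPerm (i k : ι) (τ : Perm {x : ι // x ≠ i}) : Perm ι := swap i k * ofSubtype τ

theorem extendPerm_self (i k : ι) (τ : Perm {x : ι // x ≠ i}) : extendPerm i k τ i = k := by
  rw [extendPerm, Perm.mul_apply, ofSubtype_apply_of_not_mem _ (by simp), swap_apply_left]

theorem extendPerm_coe_of_eq {i k : ι} {τ : Perm {x : ι // x ≠ i}} {x : {x : ι // x ≠ i}}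
    (h : (τ x : ι) = k) : extendPerm i k τ x = i := by
  rw [extendPerm, Perm.mul_apply, ofSubtype_apply_coe, h, swap_apply_right]

theorem extendPerm_coe_of_ne {i k : ι} {τ : Perm {x : ι // x ≠ i}} {x : {x : ι // x ≠ i}}
    (h : (τ x : ι) ≠ k) : extendPerm i k τ x = τ x := by
  rw [extendPerm, Perm.mul_apply, ofSubtype_apply_coe, swap_apply_of_ne_of_ne (τ x).2 h]

theorem extendPerm_bijective (i : ι) :
    Function.Bijective fun p : ι × Perm {x : ι // x ≠ i} => extendPerm i p.1 p.2 := by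
  constructor
  · rintro ⟨k, τ⟩ ⟨k', τ'⟩ h
    have hk : k = k' := by
      have := Equiv.congr_fun h i
      simpa only [extendPerm_self] using this
    subst hk
    simp only [extendPerm, mul_right_inj] at h
    rw [ofSubtype_injective h]
  · intro σ
    have hfix : (swap i (σ i) * σ) i = i := by simp
    refine ⟨(σ i, (swap i (σ i) * σ).subtypePerm (p := fun x => x ≠ i) fun x => ?_), ?_⟩
    · exact not_congr ⟨fun h => (swap i (σ i) * σ).injective (h.trans hfix.symm), fun h => h ▸ hfix⟩
    · simp only [extendPerm]
      refine (congrArg (swap i (σ i) * ·) (ofSubtype_subtypePerm (p := fun x => x ≠ i) _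
        fun x hx h => hx (by rw [h]; exact hfix))).trans ?_
      rw [← mul_assoc, swap_mul_self, one_mul]

theorem sign_extendPerm_of_ne [Fintype ι] {i k : ι} (h : k ≠ i) (τ : Perm {x : ι // x ≠ i}) :
    sign (extendPerm i k τ) = -sign τ := by
  rw [extendPerm, Perm.sign_mul, sign_swap h.symm, sign_ofSubtype, neg_one_mul]

theorem sign_extendPerm_self [Fintype ι] (i : ι) (τ : Perm {x : ι // x ≠ i}) :
    sign (extendPerm i i τ) = sign τ := by
  rw [extendPerm, swap_self, ← Perm.one_def, one_mul, sign_ofSubtype]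

/-- The matrix of the right cofactor has, at the place reached from `y` by `τ`, the entry of `A`
at the place reached from `y` after the insertion of `i` before `k`. -/
theorem apply_extendPerm_coe [Ring R] (A : Matrix ι ι R) {i k : ι} (τ : Perm {x : ι // x ≠ i})
    (y : {x : ι // x ≠ i}) :
    A y (extendPerm i k τ y) = minor (A.updateCol k fun s => A s i) i y (τ y) := by
  by_cases h : (τ y : ι) = k
  · rw [extendPerm_coe_of_eq h]
    simp [minor, h]
  · rw [extendPerm_coe_of_ne h]
    simp [minor, Matrix.updateCol_ne h]

theorem extendPerm_self_pow_coe (i : ι) (τ : Perm {x : ι // x ≠ i}) (x : {x : ι // x ≠ i}) (t : ℕ) :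
    (extendPerm i i τ ^ t) (x : ι) = ((τ ^ t) x : {x : ι // x ≠ i}) := by
  induction t with
  | zero => rfl
  | succ t ih =>
    rw [pow_succ', Perm.mul_apply, ih, pow_succ', Perm.mul_apply, extendPerm_coe_of_ne (τ _).2]

theorem sameCycle_extendPerm_self_self {i x : ι} {τ : Perm {x : ι // x ≠ i}} :
    (extendPerm i i τ).SameCycle i x ↔ x = i := by
  refine ⟨fun h => ?_, fun h => by rw [h]⟩
  have : (extendPerm i i τ) i = i := extendPerm_self i i τ
  exact (h.eq_of_left this).symm

theorem cycleProd_extendPerm_self_self [Ring R] (A : Matrix ι ι R) (i : ι) (τ : Perm {x : ι // x ≠ i}) :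
    cycleProd A (extendPerm i i τ) i = A i i := by
  have : Function.minimalPeriod (extendPerm i i τ) i = 1 :=
    Function.minimalPeriod_eq_one_iff_isFixedPt.2 (extendPerm_self i i τ)
  simp [cycleProd, this, extendPerm_self]

theorem cycleProd_extendPerm_self_coe [Ring R] (A : Matrix ι ι R) {i : ι} (τ : Perm {x : ι // x ≠ i})
    (x : {x : ι // x ≠ i}) : cycleProd A (extendPerm i i τ) x = cycleProd (minor A i) τ x :=
  cycleProd_eq_of_orbit Subtype.val_injective (extendPerm_self_pow_coe i τ x) fun _ _ => rfl

variable {i : ι} {k : {x : ι // x ≠ i}} {τ : Perm {x : ι // x ≠ i}}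

theorem extendPerm_pow_coe {x : {x : ι // x ≠ i}} (h : ¬τ.SameCycle k x) (t : ℕ) :
    (extendPerm i k τ ^ t) (x : ι) = ((τ ^ t) x : {x : ι // x ≠ i}) := by
  induction t with
  | zero => rfl
  | succ t ih =>
    rw [pow_succ', Perm.mul_apply, ih, pow_succ', Perm.mul_apply]
    refine extendPerm_coe_of_ne fun h' => h ?_
    have h' : τ ((τ ^ t) x) = k := Subtype.ext h'
    rw [← h', sameCycle_apply_left, sameCycle_pow_left]

/-- The cycle of `extendPerm i k τ` through `i` is `i` followed by the cycle of `τ` through `k`. -/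
theorem extendPerm_pow_succ_self (t : ℕ) (ht : t < Function.minimalPeriod τ k) :
    (extendPerm i k τ ^ (t + 1)) i = ((τ ^ t) k : {x : ι // x ≠ i}) := by
  induction t with
  | zero => simp [extendPerm_self]
  | succ t ih =>
    rw [pow_succ', Perm.mul_apply, ih (by omega)]
    have := pow_apply_ne_of_lt_minimalPeriod (Nat.succ_ne_zero t) ht
    rw [pow_succ', Perm.mul_apply] at this ⊢
    exact extendPerm_coe_of_ne fun h' => this (Subtype.ext h')

theorem cycleProd_extendPerm_coe [Ring R] (A : Matrix ι ι R) {x : {x : ι // x ≠ i}}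
    (h : ¬τ.SameCycle k x) :
    cycleProd A (extendPerm i k τ) x =
      cycleProd (minor (A.updateCol k fun s => A s i) i) τ x :=
  cycleProd_eq_of_orbit Subtype.val_injective (extendPerm_pow_coe h) fun y hy => by
    rw [← apply_extendPerm_coe, extendPerm_coe_of_ne]
    intro h'
    have h' : τ y = k := Subtype.ext h'
    exact h (h' ▸ (sameCycle_apply_right.2 hy).symm)

variable [Fintype ι]

theorem extendPerm_pow_minimalPeriod_succ_self :
    (extendPerm i k τ ^ (Function.minimalPeriod τ k + 1)) i = i := by
  obtain ⟨n, hn⟩ := Nat.exists_eq_succ_of_ne_zero (minimalPeriod_pos τ k).ne'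
  rw [pow_succ', Perm.mul_apply, hn, Nat.succ_eq_add_one, extendPerm_pow_succ_self n (by omega)]
  have := pow_minimalPeriod_apply τ k
  rw [hn, Nat.succ_eq_add_one, pow_succ', Perm.mul_apply] at this
  exact extendPerm_coe_of_eq (congrArg Subtype.val this)

theorem minimalPeriod_extendPerm_self :
    Function.minimalPeriod (extendPerm i k τ) i = Function.minimalPeriod τ k + 1 := by
  refine minimalPeriod_eq_of_first_return (Nat.succ_pos _)
    extendPerm_pow_minimalPeriod_succ_self fun t h0 ht => ?_
  obtain ⟨s, rfl⟩ := Nat.exists_eq_succ_of_ne_zero h0.ne'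
  rw [Nat.succ_eq_add_one, extendPerm_pow_succ_self s (by omega)]
  exact ((τ ^ s) k).2

theorem sameCycle_extendPerm_self_iff {x : {x : ι // x ≠ i}} :
    (extendPerm i k τ).SameCycle i x ↔ τ.SameCycle k x := by
  constructor
  · intro h
    by_contra h'
    obtain ⟨n, hn⟩ := h.symm.exists_nat_pow_eq
    rw [extendPerm_pow_coe h'] at hn
    exact ((τ ^ n) x).2 hn
  · intro h
    obtain ⟨t, ht, rfl⟩ := SameCycle.exists_pow_lt_minimalPeriod h
    rw [← extendPerm_pow_succ_self t ht]
    exact sameCycle_pow_right.2 (SameCycle.refl _ _)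

theorem sameCycle_extendPerm_coe_iff {x y : {x : ι // x ≠ i}} (h : ¬τ.SameCycle k x) :
    (extendPerm i k τ).SameCycle x y ↔ τ.SameCycle x y := by
  simp only [sameCycle_iff_exists_nat_pow, extendPerm_pow_coe h, Subtype.coe_inj]

theorem cycleProd_extendPerm_self [Ring R] (A : Matrix ι ι R) :
    cycleProd A (extendPerm i k τ) i =
      A i k * cycleProd (minor (A.updateCol k fun s => A s i) i) τ k := by
  unfold cycleProd
  rw [minimalPeriod_extendPerm_self, List.prod_range_succ', pow_zero, Perm.one_apply, zero_add,
    pow_one, extendPerm_self]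
  congr 2
  refine List.map_congr_left fun t ht => ?_
  rw [Nat.succ_eq_add_one, pow_succ' _ (t + 1), Perm.mul_apply,
    extendPerm_pow_succ_self t (List.mem_range.1 ht), pow_succ',
    Perm.mul_apply]
  exact apply_extendPerm_coe A τ _

end Expansion

/-! ### Cofactor expansion -/

section CofactorExpansion

theorem sortedLT_map_val {ι : Type*} [LinearOrder ι] {i : ι} {l : List {x : ι // x ≠ i}} (h : l.SortedLT) :
    (l.map Subtype.val).SortedLT :=
  ((List.pairwise_map (f := Subtype.val)).2 (h.pairwise.imp fun h => h)).sortedLT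

variable {ι R : Type*} [Fintype ι] [LinearOrder ι] [Ring R]

theorem otherCycles_extendPerm {i : ι} (k : {x : ι // x ≠ i}) (τ : Perm {x : ι // x ≠ i}) :
    otherCycles (extendPerm i k τ) i = (otherCycles τ k).map Subtype.val := by
  refine eq_of_sortedLT_of_mem_iff (sortedLT_otherCycles _ _)
    (sortedLT_map_val (sortedLT_otherCycles _ _)) fun x => ?_
  rw [mem_otherCycles, List.mem_map]
  constructor
  · rintro ⟨h, hmin⟩
    have hx : x ≠ i := fun h' => h (by rw [h'])
    lift x to {x : ι // x ≠ i} using hx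
    rw [sameCycle_extendPerm_self_iff] at h
    exact ⟨x, mem_otherCycles.2 ⟨h, fun y hy =>
      hmin y ((sameCycle_extendPerm_coe_iff h).2 hy)⟩, rfl⟩
  · rintro ⟨x, hx, rfl⟩
    obtain ⟨h, hmin⟩ := mem_otherCycles.1 hx
    have h' : ¬(extendPerm i k τ).SameCycle i x := mt sameCycle_extendPerm_self_iff.1 h
    refine ⟨h', fun y hy => ?_⟩
    have hyi : y ≠ i := fun hyi => h' (hyi ▸ hy.symm)
    lift y to {x : ι // x ≠ i} using hyi
    exact hmin y ((sameCycle_extendPerm_coe_iff h).1 hy)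

theorem sum_extendPerm_of_ne (A : Matrix ι ι R) (i : ι) (k : {x : ι // x ≠ i}) :
    ∑ τ : Perm {x : ι // x ≠ i}, ((sign (extendPerm i k τ) : ℤ) : R) *
      (cycleProd A (extendPerm i k τ) i *
        ((otherCycles (extendPerm i k τ) i).map (cycleProd A (extendPerm i k τ))).prod) =
      A i k * -rdet k (minor (A.updateCol k fun s => A s i) i) := by
  rw [rdet, ← Finset.sum_neg_distrib, Finset.mul_sum]
  refine Finset.sum_congr rfl fun τ _ => ?_
  rw [sign_extendPerm_of_ne k.2, cycleProd_extendPerm_self, otherCycles_extendPerm, List.map_map,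
    List.map_congr_left (f := cycleProd A (extendPerm i k τ) ∘ Subtype.val)
      (g := cycleProd (minor (A.updateCol k fun s => A s i) i) τ) fun m hm =>
        cycleProd_extendPerm_coe A (mem_otherCycles.1 hm).1]
  rw [Units.val_neg, Int.cast_neg, neg_mul, mul_neg, ← mul_assoc, ← mul_assoc, ← mul_assoc,
    ← mul_assoc, (Int.cast_commute _ (A i k)).eq]
  rfl

theorem sameCycle_extendPerm_self_coe {i : ι} {τ : Perm {x : ι // x ≠ i}}
    {x y : {x : ι // x ≠ i}} : (extendPerm i i τ).SameCycle x y ↔ τ.SameCycle x y := by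
  simp only [sameCycle_iff_exists_nat_pow, extendPerm_self_pow_coe, Subtype.coe_inj]

theorem otherCycles_extendPerm_self {i : ι} (k : {x : ι // x ≠ i}) (hk : ∀ x, k ≤ x)
    (τ : Perm {x : ι // x ≠ i}) :
    otherCycles (extendPerm i i τ) i = (k :: otherCycles τ k).map Subtype.val := by
  have hs : (k :: otherCycles τ k).SortedLT := by
    refine (List.pairwise_cons.2 ⟨fun x hx => lt_of_le_of_ne (hk x) fun h => ?_,
      (sortedLT_otherCycles τ k).pairwise⟩).sortedLT
    exact (mem_otherCycles.1 hx).1 (h ▸ SameCycle.refl _ _)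
  refine eq_of_sortedLT_of_mem_iff (sortedLT_otherCycles _ _) (sortedLT_map_val hs) fun x => ?_
  rw [mem_otherCycles, List.mem_map, sameCycle_extendPerm_self_self]
  constructor
  · rintro ⟨hx, hmin⟩
    lift x to {x : ι // x ≠ i} using hx
    refine ⟨x, ?_, rfl⟩
    have hmin' : ∀ y, τ.SameCycle x y → x ≤ y := fun y hy =>
      hmin y (sameCycle_extendPerm_self_coe.2 hy)
    by_cases h : τ.SameCycle k x
    · rw [le_antisymm (hmin' k h.symm) (hk x)]
      exact List.mem_cons_self
    · exact List.mem_cons_of_mem _ (mem_otherCycles.2 ⟨h, hmin'⟩)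
  · rintro ⟨x, hx, rfl⟩
    refine ⟨x.2, fun y hy => ?_⟩
    have hyi : y ≠ i := fun hyi => x.2 (sameCycle_extendPerm_self_self.1 (hyi ▸ hy.symm))
    lift y to {x : ι // x ≠ i} using hyi
    rcases List.mem_cons.1 hx with rfl | hx
    · exact hk y
    · exact (mem_otherCycles.1 hx).2 y (sameCycle_extendPerm_self_coe.1 hy)

theorem sum_extendPerm_self (A : Matrix ι ι R) (i : ι) :
    ∑ τ : Perm {x : ι // x ≠ i}, ((sign (extendPerm i i τ) : ℤ) : R) *
      (cycleProd A (extendPerm i i τ) i *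
        ((otherCycles (extendPerm i i τ) i).map (cycleProd A (extendPerm i i τ))).prod) =
      A i i * rdetMin (minor A i) := by
  unfold rdetMin
  split_ifs with h
  · set k := Finset.univ.min' h
    have hk : ∀ x, k ≤ x := fun x => Finset.min'_le _ _ (Finset.mem_univ x)
    rw [rdet, Finset.mul_sum]
    refine Finset.sum_congr rfl fun τ _ => ?_
    rw [sign_extendPerm_self, cycleProd_extendPerm_self_self, otherCycles_extendPerm_self k hk,
      List.map_map, List.map_congr_left (f := cycleProd A (extendPerm i i τ) ∘ Subtype.val)
        (g := cycleProd (minor A i) τ) fun m _ => cycleProd_extendPerm_self_coe A τ m, List.map_cons, List.prod_cons, ← mul_assoc,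
      ← mul_assoc (A i i), (Int.cast_commute _ (A i i)).eq]
    rfl
  · have hempty : IsEmpty {x : ι // x ≠ i} :=
      ⟨fun x => h ⟨x, Finset.mem_univ x⟩⟩
    rw [Fintype.sum_unique, sign_extendPerm_self, cycleProd_extendPerm_self_self]
    have : otherCycles (extendPerm i i (default : Perm {x : ι // x ≠ i})) i = [] := by
      refine List.eq_nil_iff_forall_not_mem.2 fun m hm => ?_
      exact hempty.false ⟨m, mt sameCycle_extendPerm_self_self.2 (mem_otherCycles.1 hm).1⟩
    rw [this, Subsingleton.elim (default : Perm {x : ι // x ≠ i}) 1]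
    simp

/-- The expansion of a row determinant along its row, valid for every square matrix. -/
theorem rdet_eq_sum_mul_rightCofactor (A : Matrix ι ι R) (i : ι) :
    rdet i A = ∑ k, A i k * rightCofactor A i k := by
  rw [rdet, ← (extendPerm_bijective i).sum_comp (g := fun σ : Perm ι => ((sign σ : ℤ) : R) *
    (cycleProd A σ i * ((otherCycles σ i).map (cycleProd A σ)).prod)), Fintype.sum_prod_type]
  refine Finset.sum_congr rfl fun k _ => ?_
  unfold rightCofactor
  split_ifs with h
  · exact sum_extendPerm_of_ne A i ⟨k, h⟩
  · rw [not_not] at h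
    subst h
    exact sum_extendPerm_self A k

end CofactorExpansion

/-! ### Merging two cycles -/

section MergeCycles

variable {ι R : Type*} [DecidableEq ι] {σ : Perm ι} {i j : ι}

theorem mul_swap_apply_of_ne {x : ι} (hi : x ≠ i) (hj : x ≠ j) : (σ * swap i j) x = σ x := by
  rw [Perm.mul_apply, swap_apply_of_ne_of_ne hi hj]

theorem mul_swap_pow_apply_of_not_sameCycle {x : ι} (hi : ¬σ.SameCycle i x)
    (hj : ¬σ.SameCycle j x) (t : ℕ) : ((σ * swap i j) ^ t) x = (σ ^ t) x :=
  pow_apply_eq_of_eqOn_cycle (fun y hy => mul_swap_apply_of_ne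
    (fun h => hi (by rw [← h]; exact hy.symm)) fun h => hj (by rw [← h]; exact hy.symm)) t

/-- The cycle of `σ * swap i j` through `j` runs along the cycle of `σ` through `i` until it reaches
`i`; `mul_swap_pow_add_succ_apply_right` covers the remaining part, along the cycle through `j`. -/
theorem mul_swap_pow_succ_apply_right (hij : ¬σ.SameCycle i j) (t : ℕ)
    (ht : t < Function.minimalPeriod σ i) :
    ((σ * swap i j) ^ (t + 1)) j = (σ ^ (t + 1)) i := by
  induction t with
  | zero => simp
  | succ t ih =>
    rw [pow_succ', Perm.mul_apply, ih (by omega), mul_swap_apply_of_ne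
      (pow_apply_ne_of_lt_minimalPeriod (Nat.succ_ne_zero t) ht)
      fun h => hij (by rw [← h, sameCycle_pow_right]), ← Perm.mul_apply, ← pow_succ']

variable [Finite ι]

theorem mul_swap_pow_minimalPeriod_apply_right (hij : ¬σ.SameCycle i j) :
    ((σ * swap i j) ^ Function.minimalPeriod σ i) j = i := by
  obtain ⟨n, hn⟩ := Nat.exists_eq_succ_of_ne_zero (minimalPeriod_pos σ i).ne'
  have h := mul_swap_pow_succ_apply_right hij n (by omega)
  have hi := pow_minimalPeriod_apply σ i
  rw [hn] at hi ⊢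
  exact h.trans hi

theorem mul_swap_pow_add_succ_apply_right (hij : ¬σ.SameCycle i j) (t : ℕ)
    (ht : t < Function.minimalPeriod σ j) :
    ((σ * swap i j) ^ (Function.minimalPeriod σ i + (t + 1))) j = (σ ^ (t + 1)) j := by
  induction t with
  | zero =>
    rw [zero_add, pow_succ', Perm.mul_apply, mul_swap_pow_minimalPeriod_apply_right hij]
    simp
  | succ t ih =>
    rw [← add_assoc, pow_succ', Perm.mul_apply, ih (by omega), mul_swap_apply_of_ne
      (fun h => hij (by rw [← h, sameCycle_pow_left]))
      (pow_apply_ne_of_lt_minimalPeriod (Nat.succ_ne_zero t) ht), ← Perm.mul_apply, ← pow_succ']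

theorem minimalPeriod_mul_swap (hij : ¬σ.SameCycle i j) :
    Function.minimalPeriod (σ * swap i j) j =
      Function.minimalPeriod σ i + Function.minimalPeriod σ j := by
  have hp := minimalPeriod_pos σ i
  have hq := minimalPeriod_pos σ j
  refine minimalPeriod_eq_of_first_return (by omega) ?_ fun t h0 ht => ?_
  · obtain ⟨n, hn⟩ := Nat.exists_eq_succ_of_ne_zero hq.ne'
    have h := mul_swap_pow_add_succ_apply_right hij n (by omega)
    have hj := pow_minimalPeriod_apply σ j
    rw [hn] at hj ⊢
    exact h.trans hj
  · rcases le_or_gt t (Function.minimalPeriod σ i) with h | h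
    · obtain ⟨n, rfl⟩ := Nat.exists_eq_succ_of_ne_zero h0.ne'
      rw [Nat.succ_eq_add_one, mul_swap_pow_succ_apply_right hij n (by omega)]
      exact fun h => hij (h ▸ sameCycle_pow_right.2 (SameCycle.refl _ _))
    · obtain ⟨n, rfl⟩ := Nat.exists_eq_add_of_lt h
      rw [add_assoc, mul_swap_pow_add_succ_apply_right hij n (by omega)]
      exact pow_apply_ne_of_lt_minimalPeriod (Nat.succ_ne_zero n) (by omega)

/-- If the rows `i` and `j` coincide, merging the cycles through `i` and `j` concatenates their
products. -/
theorem cycleProd_mul_swap [Ring R] {B : Matrix ι ι R} (hij : ¬σ.SameCycle i j) (hB : B j = B i) :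
    cycleProd B (σ * swap i j) j = cycleProd B σ i * cycleProd B σ j := by
  unfold cycleProd
  rw [minimalPeriod_mul_swap hij, List.range_add, List.map_append, List.prod_append, List.map_map]
  congr 2
  · refine List.map_congr_left fun t ht => ?_
    have ht := List.mem_range.1 ht
    rw [mul_swap_pow_succ_apply_right hij t ht]
    cases t with
    | zero => exact congrFun hB _
    | succ t => rw [mul_swap_pow_succ_apply_right hij t (by omega)]
  · refine List.map_congr_left fun t ht => ?_
    have ht := List.mem_range.1 ht
    rw [Function.comp_apply, add_assoc, mul_swap_pow_add_succ_apply_right hij t ht]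
    cases t with
    | zero =>
      rw [add_zero, mul_swap_pow_minimalPeriod_apply_right hij]
      exact (congrFun hB _).symm
    | succ t => rw [mul_swap_pow_add_succ_apply_right hij t (by omega)]

theorem sameCycle_mul_swap_iff_of_not_sameCycle {x y : ι} (hi : ¬σ.SameCycle i x)
    (hj : ¬σ.SameCycle j x) : (σ * swap i j).SameCycle x y ↔ σ.SameCycle x y := by
  simp only [sameCycle_iff_exists_nat_pow, mul_swap_pow_apply_of_not_sameCycle hi hj]

theorem sameCycle_mul_swap_right_iff {x : ι} (hij : ¬σ.SameCycle i j) :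
    (σ * swap i j).SameCycle j x ↔ σ.SameCycle i x ∨ σ.SameCycle j x := by
  constructor
  · intro h
    by_contra! hx
    exact hx.2 ((sameCycle_mul_swap_iff_of_not_sameCycle hx.1 hx.2).1 h.symm).symm
  · rintro (h | h) <;> obtain ⟨t, ht, rfl⟩ := SameCycle.exists_pow_lt_minimalPeriod h
    · cases t with
      | zero =>
        exact ⟨Function.minimalPeriod σ i, by simpa using mul_swap_pow_minimalPeriod_apply_right hij⟩
      | succ t =>
        rw [← mul_swap_pow_succ_apply_right hij t (by omega)]
        exact sameCycle_pow_right.2 (SameCycle.refl _ _)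
    · cases t with
      | zero => exact SameCycle.refl _ _
      | succ t =>
        rw [← mul_swap_pow_add_succ_apply_right hij t (by omega)]
        exact sameCycle_pow_right.2 (SameCycle.refl _ _)

/-- Multiplication by the transposition of two elements of one cycle separates them. -/
theorem not_sameCycle_mul_swap (hne : i ≠ j) (hij : σ.SameCycle i j) :
    ¬(σ * swap i j).SameCycle i j := by
  classical
  have hex := hij.symm.exists_nat_pow_eq
  -- the cycle of `σ * swap i j` through `i` closes up before it would reach `j`
  set l := Nat.find hex
  have hl : (σ ^ l) j = i := Nat.find_spec hex
  have hmin : ∀ t < l, (σ ^ t) j ≠ i := fun t ht => Nat.find_min hex ht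
  have hj : ∀ t, 0 < t → t < l → (σ ^ t) j ≠ j := fun t h0 ht h => by
    refine hmin (l - t) (by omega) ?_
    conv_lhs => rw [← h]
    rw [← Perm.mul_apply, ← pow_add, Nat.sub_add_cancel ht.le, hl]
  have h0 : 0 < l := Nat.pos_of_ne_zero fun h => hne (by rw [← hl, h, pow_zero, Perm.one_apply])
  have hpow : ∀ t < l, ((σ * swap i j) ^ (t + 1)) i = (σ ^ (t + 1)) j := fun t ht => by
    induction t with
    | zero => simp
    | succ t ih =>
      rw [pow_succ', Perm.mul_apply, ih (by omega), mul_swap_apply_of_ne (hmin _ ht)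
        (hj _ (Nat.succ_pos t) ht), ← Perm.mul_apply, ← pow_succ']
  have hper : Function.IsPeriodicPt (σ * swap i j) l i := by
    rw [Function.IsPeriodicPt, Function.IsFixedPt, Perm.iterate_eq_pow]
    have := hpow (l - 1) (by omega)
    rwa [Nat.sub_add_cancel h0, hl] at this
  intro h
  obtain ⟨n, hn⟩ := h.exists_nat_pow_eq
  rw [← Perm.iterate_eq_pow, ← hper.iterate_mod_apply, Perm.iterate_eq_pow] at hn
  have hlt : n % l < l := Nat.mod_lt _ h0
  cases hr : n % l with
  | zero =>
    rw [hr] at hn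
    exact hne hn
  | succ t =>
    rw [hr] at hn hlt
    rw [hpow t (by omega)] at hn
    exact hj _ (Nat.succ_pos t) hlt hn

end MergeCycles

/-! ### Vanishing for a repeated row -/

section EqualRows

variable {ι : Type*} [Fintype ι] [LinearOrder ι]

open Classical in
theorem otherCycles_mul_swap {σ : Perm ι} {i j : ι} (hij : ¬σ.SameCycle i j) :
    otherCycles (σ * swap i j) j = (otherCycles σ j).filter fun m => ¬σ.SameCycle i m := by
  refine eq_of_sortedLT_of_mem_iff (sortedLT_otherCycles _ _)
    ((sortedLT_otherCycles σ j).pairwise.filter _).sortedLT fun x => ?_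
  simp only [mem_otherCycles, List.mem_filter, decide_eq_true_eq, sameCycle_mul_swap_right_iff hij,
    not_or]
  constructor
  · rintro ⟨⟨hi, hj⟩, hmin⟩
    exact ⟨⟨hj, fun k hk => hmin k ((sameCycle_mul_swap_iff_of_not_sameCycle hi hj).2 hk)⟩, hi⟩
  · rintro ⟨⟨hj, hmin⟩, hi⟩
    exact ⟨⟨hi, hj⟩, fun k hk => hmin k ((sameCycle_mul_swap_iff_of_not_sameCycle hi hj).1 hk)⟩

open Classical in
/-- Representatives of the cycles of `σ` in the order in which they occur in the monomial of
`σ * swap i j` in the `j`-th row determinant, for `i` and `j` in different cycles of `σ`: the cycle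
through `i` is followed by the one through `j`. -/
def splitCycles (i j : ι) (σ : Perm ι) : List ι :=
  i :: j :: (otherCycles σ j).filter fun m => ¬σ.SameCycle i m

theorem splitCycles_congr {σ τ : Perm ι} {i j : ι}
    (h : ∀ x y, σ.SameCycle x y ↔ τ.SameCycle x y) : splitCycles i j σ = splitCycles i j τ := by
  simp only [splitCycles, otherCycles_congr h, h]

theorem pairwise_splitCycles {σ : Perm ι} {i j : ι} (hij : ¬σ.SameCycle i j) :
    (splitCycles i j σ).Pairwise fun x y => ¬σ.SameCycle x y := by
  refine List.pairwise_cons.2 ⟨fun m hm => ?_, (pairwise_cons_otherCycles σ j).sublist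
    (List.Sublist.cons_cons _ List.filter_sublist)⟩
  rcases List.mem_cons.1 hm with rfl | hm
  · exact hij
  · simpa using (List.mem_filter.1 hm).2

theorem prod_map_cycleProd_mul_swap {B : Matrix ι ι ℍ[ℝ]} {σ : Perm ι} {i j : ι}
    (hij : ¬σ.SameCycle i j) (hB : B j = B i) :
    ((j :: otherCycles (σ * swap i j) j).map (cycleProd B (σ * swap i j))).prod =
      ((splitCycles i j σ).map (cycleProd B σ)).prod := by
  rw [List.map_cons, List.prod_cons, cycleProd_mul_swap hij hB, splitCycles, List.map_cons,
    List.map_cons, List.prod_cons, List.prod_cons, mul_assoc, otherCycles_mul_swap hij]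
  congr 3
  refine List.map_congr_left fun m hm => ?_
  obtain ⟨hm, hi⟩ := List.mem_filter.1 hm
  simp only [decide_eq_true_eq] at hi
  have hj := (mem_otherCycles.1 hm).1
  exact cycleProd_congr (fun y hy => mul_swap_apply_of_ne
    (fun h => hi (by rw [← h]; exact hy.symm)) fun h => hj (by rw [← h]; exact hy.symm))
    fun _ _ => rfl

theorem prod_mixedFactor_splitCycles (B : Matrix ι ι ℍ[ℝ]) {σ : Perm ι} {i j : ι}
    (hij : ¬σ.SameCycle i j) :
    ((splitCycles i j σ).map (mixedFactor B (Finset.univ.erase j) σ)).prod =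
      ((j :: otherCycles σ j).map (mixedFactor B (Finset.univ.erase j) σ)).prod := by
  classical
  have hre : ∀ l : List ι, (∀ m ∈ l, ¬σ.SameCycle j m) →
      (l.map (mixedFactor B (Finset.univ.erase j) σ)).prod =
        (((l.map fun m => (cycleProd B σ m).re).prod : ℝ) : ℍ[ℝ]) := fun l hl => by
    rw [← prod_map_coe]
    congr 1
    refine List.map_congr_left fun m hm => ?_
    have : m ≠ j := fun h => hl m hm (by rw [h])
    simp [mixedFactor, this]
  have ho : ∀ m ∈ otherCycles σ j, ¬σ.SameCycle j m := fun m hm => (mem_otherCycles.1 hm).1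
  have hi : ¬σ.SameCycle j i := fun h => hij h.symm
  have hsplit := pairwise_splitCycles hij
  rw [splitCycles, List.pairwise_cons, List.pairwise_cons] at hsplit
  obtain ⟨hsi, -, hs⟩ := hsplit
  -- the two lists of representatives of the cycles that do not contain `j`
  have hprod : (((i :: (otherCycles σ j).filter fun m => ¬σ.SameCycle i m).map
      fun m => (cycleProd B σ m).re).prod : ℝ) =
      ((otherCycles σ j).map fun m => (cycleProd B σ m).re).prod := by
    refine prod_map_eq_of_representatives (σ := σ)
      (fun _ _ h => re_cycleProd_eq_of_sameCycle B h)
      (List.pairwise_cons.2 ⟨fun m hm => hsi m (List.mem_cons_of_mem _ hm), hs⟩)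
      (pairwise_otherCycles σ j) (fun x hx => exists_mem_otherCycles ?_) fun y hy => ?_
    · rcases List.mem_cons.1 hx with rfl | hx
      · exact hi
      · exact ho x (List.mem_of_mem_filter hx)
    · by_cases h : σ.SameCycle i y
      · exact ⟨i, by simp, h⟩
      · exact ⟨y, List.mem_cons_of_mem _ (List.mem_filter.2 ⟨hy, by simpa using h⟩),
          SameCycle.refl _ _⟩
  rw [splitCycles, List.map_cons, List.map_cons, List.map_cons, List.prod_cons, List.prod_cons,
    List.prod_cons, hre _ ho, ← hprod, hre _ fun m hm => ho m (List.mem_of_mem_filter hm),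
    List.map_cons, List.prod_cons, Quaternion.coe_mul]
  have hmi : mixedFactor B (Finset.univ.erase j) σ i = ((cycleProd B σ i).re : ℍ[ℝ]) := by
    have : i ≠ j := fun h => hij (by rw [h])
    simp [mixedFactor, this]
  rw [hmi, ← mul_assoc, ← mul_assoc, (Quaternion.coe_commute _ _).eq]

/-- A row determinant vanishes if its row in a Hermitian matrix is replaced by another row. The
monomials of `σ` and `σ * swap i j` cancel after averaging: one of the two permutations has `i` and
`j` in the same cycle, and its product is the one of the other permutation, up to the place of the
product along the cycle through `i`, which may be replaced by its real part. -/
theorem rdet_updateRow_eq_zero {A : Matrix ι ι ℍ[ℝ]} (hA : A.IsHermitian) {i j : ι} (hne : i ≠ j) :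
    rdet j (A.updateRow j (A i)) = 0 := by
  classical
  set B := A.updateRow j (A i) with hBdef
  have hBrow : B j = B i := by
    rw [hBdef, Matrix.updateRow_self, Matrix.updateRow_ne hne]
  set T : Finset (Perm ι) := Finset.univ.filter fun σ => ¬σ.SameCycle i j with hTdef
  have memT : ∀ σ, σ ∈ T ↔ ¬σ.SameCycle i j := fun σ => by simp [hTdef]
  have hTflip : ∀ m, ∀ σ ∈ T, flipCycle m σ ∈ T := fun m σ hσ =>
    (memT _).2 (mt sameCycle_flipCycle.1 ((memT σ).1 hσ))
  have hstar : ∀ (σ : Perm ι) (m : ι), ¬σ.SameCycle m j → ∀ x y, σ.SameCycle m x → σ.SameCycle m y →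
      B x y = star (B y x) := fun σ m hm x y hx hy => by
    have hxj : x ≠ j := fun h => hm (h ▸ hx)
    have hyj : y ≠ j := fun h => hm (h ▸ hy)
    rw [hBdef, Matrix.updateRow_ne hxj, Matrix.updateRow_ne hyj, hA.apply]
  -- in a list of inequivalent elements that contains `j`, no other one is equivalent to `j`
  have hrep : ∀ (σ : Perm ι) (l : List ι), (l.Pairwise fun x y => ¬σ.SameCycle x y) → j ∈ l →
      ∀ m ∈ Finset.univ.erase j, m ∈ l → ¬σ.SameCycle m j := fun σ l hl hj m hmj hm => by
    have : Std.Symm fun x y => ¬σ.SameCycle x y := ⟨fun _ _ h h' => h h'.symm⟩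
    exact hl.forall hm hj (Finset.ne_of_mem_erase hmj)
  have hcompl : ∑ σ ∈ Finset.univ.filter (fun σ : Perm ι => ¬¬σ.SameCycle i j),
      ((sign σ : ℤ) : ℍ[ℝ]) * ((j :: otherCycles σ j).map (cycleProd B σ)).prod =
      -∑ σ ∈ T, ((sign σ : ℤ) : ℍ[ℝ]) * ((splitCycles i j σ).map (cycleProd B σ)).prod := by
    rw [← Finset.sum_neg_distrib]
    refine (Finset.sum_bij' (fun σ _ => σ * swap i j) (fun σ _ => σ * swap i j) ?_ ?_ ?_ ?_ ?_).symm
    · intro σ hσ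
      have := (memT σ).1 hσ
      simp only [Finset.mem_filter, Finset.mem_univ, true_and, not_not]
      exact ((sameCycle_mul_swap_right_iff this).2 (Or.inl (SameCycle.refl _ _))).symm
    · intro σ hσ
      simp only [Finset.mem_filter, Finset.mem_univ, true_and, not_not] at hσ
      exact (memT _).2 (not_sameCycle_mul_swap hne hσ)
    · intro σ _
      rw [mul_assoc, swap_mul_self, mul_one]
    · intro σ _
      rw [mul_assoc, swap_mul_self, mul_one]
    · intro σ hσ
      rw [prod_map_cycleProd_mul_swap ((memT σ).1 hσ) hBrow, Perm.sign_mul, sign_swap hne]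
      simp
  rw [rdet_eq_sum_cons, ← Finset.sum_filter_add_sum_filter_not Finset.univ
    (fun σ : Perm ι => ¬σ.SameCycle i j), hcompl, ← hTdef,
    sum_cycleProd_eq_sum_mixedFactor (L := fun σ => j :: otherCycles σ j) (Finset.univ.erase j)
      hTflip (fun m σ _ => by rw [otherCycles_congr fun _ _ => sameCycle_flipCycle])
      (fun σ _ => pairwise_cons_otherCycles σ j)
      (fun m hm σ _ hml => hstar σ m
        (hrep σ _ (pairwise_cons_otherCycles σ j) List.mem_cons_self m hm hml)),
    sum_cycleProd_eq_sum_mixedFactor (L := splitCycles i j) (Finset.univ.erase j)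
      hTflip (fun m σ _ => splitCycles_congr fun _ _ => sameCycle_flipCycle)
      (fun σ hσ => pairwise_splitCycles ((memT σ).1 hσ))
      (fun m hm σ hσ hml => hstar σ m
        (hrep σ _ (pairwise_splitCycles ((memT σ).1 hσ)) (by simp [splitCycles]) m hm hml)),
    ← sub_eq_add_neg, sub_eq_zero]
  exact Finset.sum_congr rfl fun σ hσ => by
    rw [prod_mixedFactor_splitCycles B ((memT σ).1 hσ)]

end EqualRows

/-! ### The inverse matrix -/

section Inverse

variable {ι : Type*} [Fintype ι] [LinearOrder ι]

theorem rightCofactor_updateRow_self {R : Type*} [Ring R] (A : Matrix ι ι R) (j k : ι) (v : ι → R) :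
    rightCofactor (A.updateRow j v) j k = rightCofactor A j k := by
  unfold rightCofactor
  split_ifs with h
  · congr 2
    ext x y
    by_cases hy : (y : ι) = k
    · simp [minor, hy, Matrix.updateRow_ne x.2]
    · simp [minor, hy, Matrix.updateRow_ne x.2]
  · congr 1
    ext x y
    simp [minor, Matrix.updateRow_ne x.2]

theorem sum_mul_rightCofactor_eq_zero {A : Matrix ι ι ℍ[ℝ]} (hA : A.IsHermitian) {i j : ι}
    (hne : i ≠ j) : ∑ k, A i k * rightCofactor A j k = 0 := by
  rw [← rdet_updateRow_eq_zero hA hne, rdet_eq_sum_mul_rightCofactor]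
  exact Finset.sum_congr rfl fun k _ => by
    rw [Matrix.updateRow_self, rightCofactor_updateRow_self]

theorem star_rdetMin (A : Matrix ι ι ℍ[ℝ]) : star (rdetMin A) = cdetMin A.conjTranspose := by
  unfold rdetMin cdetMin
  split_ifs with h
  · exact star_rdet A _
  · exact star_one _

theorem star_rightCofactor (A : Matrix ι ι ℍ[ℝ]) (i j : ι) :
    star (rightCofactor A i j) = leftCofactor A.conjTranspose j i := by
  unfold rightCofactor leftCofactor
  split_ifs with h
  · rw [star_neg, star_rdet]
    congr 2
    ext1 x y
    by_cases hx : (x : ι) = j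
    · simp [minor, hx]
    · simp [minor, hx]
  · rw [star_rdetMin]
    rfl

theorem mul_transpose_rightCofactor {A : Matrix ι ι ℍ[ℝ]} (hA : A.IsHermitian) {d : ℍ[ℝ]}
    (hd : ∀ i, rdet i A = d) : A * (Matrix.of (rightCofactor A)).transpose = Matrix.scalar ι d := by
  ext1 i j
  rw [Matrix.mul_apply, Matrix.scalar_apply]
  simp only [Matrix.transpose_apply, Matrix.of_apply]
  by_cases h : i = j
  · subst h
    rw [Matrix.diagonal_apply_eq, ← rdet_eq_sum_mul_rightCofactor, hd]
  · rw [Matrix.diagonal_apply_ne _ h, sum_mul_rightCofactor_eq_zero hA h]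

variable {n : ℕ}

theorem hermDet_eq_rdet {A : Matrix (Fin n) (Fin n) ℍ[ℝ]} (hA : A.IsHermitian) (i : Fin n) :
    hermDet A = rdet i A := by
  rw [hermDet, rdetMin, dif_pos ⟨i, Finset.mem_univ i⟩]
  exact rdet_eq_rdet_of_isHermitian hA _ _

theorem exists_hermDet_eq_coe {A : Matrix (Fin n) (Fin n) ℍ[ℝ]} (hA : A.IsHermitian) :
    ∃ r : ℝ, hermDet A = (r : ℍ[ℝ]) := by
  unfold hermDet rdetMin
  split_ifs with h
  · exact ⟨_, rdet_eq_coe_of_isHermitian hA _⟩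
  · exact ⟨1, Quaternion.coe_one.symm⟩

theorem mul_rightInv {A : Matrix (Fin n) (Fin n) ℍ[ℝ]} (hA : A.IsHermitian)
    (hd : hermDet A ≠ 0) : A * rightInv A = 1 := by
  obtain ⟨r, hr⟩ := exists_hermDet_eq_coe hA
  rw [hr] at hd
  have hcomm : ∀ M : Matrix (Fin n) (Fin n) ℍ[ℝ], (hermDet A)⁻¹ • M = r⁻¹ • M := fun M => by
    ext1 i j
    rw [Matrix.smul_apply, Matrix.smul_apply, hr, ← Quaternion.coe_inv, smul_eq_mul,
      Quaternion.coe_mul_eq_smul]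
  rw [rightInv, hcomm, Matrix.mul_smul,
    mul_transpose_rightCofactor hA fun i => (hermDet_eq_rdet hA i).symm.trans hr]
  ext1 i j
  rw [Matrix.smul_apply, Matrix.scalar_apply]
  by_cases h : i = j
  · subst h
    rw [Matrix.diagonal_apply_eq, Matrix.one_apply_eq, ← Quaternion.coe_mul_eq_smul,
      Quaternion.coe_inv, inv_mul_cancel₀ hd]
  · rw [Matrix.diagonal_apply_ne _ h, Matrix.one_apply_ne h, smul_zero]

theorem conjTranspose_rightInv {A : Matrix (Fin n) (Fin n) ℍ[ℝ]} (hA : A.IsHermitian) :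
    (rightInv A).conjTranspose = leftInv A := by
  obtain ⟨r, hr⟩ := exists_hermDet_eq_coe hA
  ext1 i j
  have h : star (rightCofactor A i j) = leftCofactor A j i := by
    rw [star_rightCofactor, hA.eq]
  rw [Matrix.conjTranspose_apply, rightInv, leftInv, Matrix.smul_apply, Matrix.smul_apply,
    Matrix.transpose_apply, Matrix.transpose_apply, Matrix.of_apply, Matrix.of_apply, smul_eq_mul,
    smul_eq_mul, star_mul, h, hr, ← Quaternion.coe_inv, Quaternion.star_coe,
    (Quaternion.coe_commute _ _).eq]

end Inverse

end QuatDet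

theorem theorem5p1 (n : ℕ) (hn : 1 ≤ n) (A : Matrix (Fin n) (Fin n) (Quaternion ℝ))
    (hA : A.IsHermitian) :
    -- `det A` is well defined: it is real and equal to every row and every column determinant
    (∃ r : ℝ, QuatDet.hermDet A = (r : Quaternion ℝ)) ∧
    (∀ i : Fin n, QuatDet.rdet i A = QuatDet.hermDet A ∧ QuatDet.cdet i A = QuatDet.hermDet A) ∧
    -- if `det A ≠ 0`, the right inverse and the left inverse exist, are unique, have the stated
    -- form, and coincide
    (QuatDet.hermDet A ≠ 0 →
      (A * QuatDet.rightInv A = 1 ∧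
        ∀ B : Matrix (Fin n) (Fin n) (Quaternion ℝ), A * B = 1 → B = QuatDet.rightInv A) ∧
      (QuatDet.leftInv A * A = 1 ∧
        ∀ C : Matrix (Fin n) (Fin n) (Quaternion ℝ), C * A = 1 → C = QuatDet.leftInv A) ∧
      QuatDet.rightInv A = QuatDet.leftInv A) := by
  obtain ⟨r, hr⟩ := QuatDet.exists_hermDet_eq_coe hA
  refine ⟨⟨r, hr⟩, fun i => ⟨(QuatDet.hermDet_eq_rdet hA i).symm, ?_⟩, fun hd => ?_⟩
  · have h := QuatDet.star_rdet A i
    rw [hA.eq, ← QuatDet.hermDet_eq_rdet hA i, hr, Quaternion.star_coe] at h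
    rw [← h, hr]
  · have hright := QuatDet.mul_rightInv hA hd
    have hleft : QuatDet.leftInv A * A = 1 := by
      have h := congrArg Matrix.conjTranspose hright
      rwa [Matrix.conjTranspose_mul, QuatDet.conjTranspose_rightInv hA, hA.eq,
        Matrix.conjTranspose_one] at h
    have heq : QuatDet.leftInv A = QuatDet.rightInv A := left_inv_eq_right_inv hleft hright
    exact ⟨⟨hright, fun B hB => (left_inv_eq_right_inv hleft hB).symm.trans heq⟩,
      ⟨hleft, fun C hC => (left_inv_eq_right_inv hC hright).trans heq.symm⟩, heq.symm⟩
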